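/- Let $X$ be a real or complex Banach space and let $GL(X)$ be the group of invertible bounded linear operators on $X$, with the topology given by the metric $d(S,T)=\|S-T\|+\|S^{-1}-T^{-1}\|$. Let $M$ be a Polish space (for example a compact metric space, or a compact manifold), $f:M\to M$ a homeomorphism, $\mu$ an $f$-invariant Borel probability measure on $M$, and $A:M\to GL(X)$ continuous. For a Borel probability measure $\nu$ on $M$, a map $C:M\to GL(X)$ is called $\nu$-continuous if there are compact sets $K_n\subset M$ $(n\ge 1)$ with $\nu(\bigcup_{n\geq 1} K_n)=1$ such that $C|_{K_n}$ is continuous for every $n$. The ergodic components of $\mu$ are the conditional probability measures $\mu_x$ $(x\in M)$ of $\mu$ with respect to the $\sigma$-algebra of $f$-invariant Borel sets; a property holds for almost every ergodic component if it holds for $\mu_x$ for $\mu$-a.e. $x\in M$. Suppose that for almost every ergodic component $\nu$ of $\mu$ there exists a $\nu$-continuous map $C_\nu:M\to GL(X)$ such that $A(x)=C_\nu(f(x))\,C_\nu(x)^{-1}$ for $\nu$-a.e. $x\in M$. Then there exists a $\mu$-continuous map $C:M\to GL(X)$ such that $$A(x)=C(f(x))\,C(x)^{-1}\quad\text{for }\mu\text{-a.e.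 }x\in M.$$ -/

import Mathlib

open MeasureTheory ProbabilityTheory

/-- `GL(X)`: the group of invertible bounded linear operators on `X`, with the topology of units,
that is, the one induced by the map sending `T` to the pair `(T, T⁻¹)` in the operator norm. This
is the topology of the metric `d(S, T) = ‖S - T‖ + ‖S⁻¹ - T⁻¹‖`. Multiplication is composition. -/
abbrev BanachGL (𝕜 X : Type*) [RCLike 𝕜] [NormedAddCommGroup X] [NormedSpace 𝕜 X] : Type _ :=
  (X →L[𝕜] X)ˣ

/-- A map `C` on `M` is `ν`-continuous if there are countably many compact sets whose union has
`ν`-measure one and to each of which the restriction of `C` is continuous. -/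
def IsMeasureContinuous {M Y : Type*} [TopologicalSpace M] [MeasurableSpace M]
    [TopologicalSpace Y] (ν : Measure M) (C : M → Y) : Prop :=
  ∃ K : ℕ → Set M, (∀ n, IsCompact (K n)) ∧ ν (⋃ n, K n) = 1 ∧ ∀ n, ContinuousOn C (K n)

/-- `C` solves the cohomological equation `A = (C ∘ f) C⁻¹` at `ν`-almost every point. -/
def SolvesCohomologicalEquation {M G : Type*} [MeasurableSpace M] [Group G]
    (f : M → M) (ν : Measure M) (A C : M → G) : Prop :=
  ∀ᵐ x ∂ν, A x = C (f x) * (C x)⁻¹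

/-- The ergodic component of `μ` at the point `x`: the conditional probability measure of `μ` at
`x` given the sigma-algebra of measurable sets `s` with `f ⁻¹' s = s`. For an invariant probability
measure `μ` on a standard Borel space, the family of these measures, indexed by `x` with
distribution `μ`, is the ergodic decomposition of `μ`. -/
noncomputable def ergodicComponent {M : Type*} [MeasurableSpace M] [StandardBorelSpace M]
    (f : M → M) (μ : Measure M) [IsFiniteMeasure μ] (x : M) : Measure M :=
  condExpKernel μ (MeasurableSpace.invariants f) x

open Set Filter Topology

/-! The difficulty is to glue uncountably many solutions measurably, although `GL(X)` need not be
separable. Two devices overcome it. A single Polish group suffices: the values of `A` lie in a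
closed Polish subgroup `G`, since `M` is separable. A solution on one component lies, almost
everywhere, in a Polish subgroup `H` that contains the values of `A`. The coset of `C(y)⁻¹` modulo
`G ∩ H` is `f`-invariant, so a measurable choice of representatives corrects `C` on the right by an
invariant function and brings it into `G`
(`SolvesCohomologicalEquation.exists_measurable_subgroup`). Measurable maps `M → G`, up to null
sets, are then coded by points `z` of a standard Borel space through one jointly measurable `E`
(`exists_universal_measurable_family`). Being a code of a solution on the component at `x` is a
Borel condition on `(x, z)`. Von Neumann selection (`exists_measurable_section_ae`) picks `z` as a
measurable function of the component alone, hence invariantly, and `C(x) = E(z(x), x)` is the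
solution; Lusin's theorem makes it `μ`-continuous. -/

/-! ### Measurable selection -/

/-- Capacitability of images of the Baire space: almost all of the mass carried by the range of a
continuous map is carried by the image of a compact set. -/
theorem exists_isCompact_le_measure_preimage_image {Ω Y : Type*} [MeasurableSpace Ω]
    {μ : Measure Ω} [IsFiniteMeasure μ] [TopologicalSpace Y] [T2Space Y] [MeasurableSpace Y]
    [BorelSpace Y] {h : (ℕ → ℕ) → Y} (hh : Continuous h) {θ : Ω → Y} (hθ : Measurable θ)
    (hr : ∀ᵐ x ∂μ, θ x ∈ range h) {c : ENNReal} (hc : c < μ univ) :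
    ∃ K : Set (ℕ → ℕ), IsCompact K ∧ c ≤ μ (θ ⁻¹' (h '' K)) := by
  have step : ∀ (k : ℕ) (S : Set (ℕ → ℕ)), ∃ m : ℕ, c < μ (θ ⁻¹' (h '' S)) →
      c < μ (θ ⁻¹' (h '' (S ∩ {t | t k ≤ m}))) := by
    intro k S
    by_cases hS : c < μ (θ ⁻¹' (h '' S))
    · have hU : θ ⁻¹' (h '' S) = ⋃ m : ℕ, θ ⁻¹' (h '' (S ∩ {t | t k ≤ m})) := by
        rw [← preimage_iUnion, ← image_iUnion, ← inter_iUnion]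
        congr 2
        refine (inter_eq_left.2 fun t _ => mem_iUnion.2 ⟨t k, ?_⟩).symm
        simp
      have hmono : Monotone fun m : ℕ => θ ⁻¹' (h '' (S ∩ {t | t k ≤ m})) := by
        intro a b hab
        refine preimage_mono (image_mono (inter_subset_inter_right _ ?_))
        intro t ht
        exact le_trans ht hab
      rw [hU, hmono.measure_iUnion] at hS
      obtain ⟨m, hm⟩ := lt_iSup_iff.1 hS
      exact ⟨m, fun _ => hm⟩
    · exact ⟨0, fun h' => absurd h' hS⟩
  choose m hm using step
  let S : ℕ → Set (ℕ → ℕ) := fun k => Nat.rec univ (fun k S => S ∩ {t | t k ≤ m k S}) k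
  have hS0 : S 0 = univ := rfl
  have hSs : ∀ k, S (k + 1) = S k ∩ {t | t k ≤ m k (S k)} := fun k => rfl
  have hSpos : ∀ k, c < μ (θ ⁻¹' (h '' S k)) := by
    intro k
    induction k with
    | zero =>
      rw [hS0, image_univ]
      refine hc.trans_eq (measure_congr ?_)
      filter_upwards [hr] with x hx
      exact propext ⟨fun _ => hx, fun _ => trivial⟩
    | succ k ih => rw [hSs]; exact hm k _ ih
  have hSmem : ∀ k t, t ∈ S k ↔ ∀ i < k, t i ≤ m i (S i) := by
    intro k
    induction k with
    | zero => intro t; simp [hS0]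
    | succ k ih =>
      intro t
      rw [hSs, mem_inter_iff, ih, Nat.forall_lt_succ_right]
      rfl
  let K : Set (ℕ → ℕ) := univ.pi fun i => Iic (m i (S i))
  have hK : IsCompact K := isCompact_univ_pi fun i => (finite_Iic _).isCompact
  have hclosure : ⋂ k, closure (h '' S k) ⊆ h '' K := by
    intro y hy
    by_contra hyK
    obtain ⟨U, V, hU, hV, hKU, hyV, hUV⟩ := (hK.image hh).separation_of_notMem hyK
    have hex : ∀ k, ∃ t ∈ S k, h t ∉ U := by
      intro k
      by_contra! hcon
      obtain ⟨_, hzV, t, htS, rfl⟩ := mem_closure_iff.1 (mem_iInter.1 hy k) V hV hyV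
      exact hUV.le_bot ⟨hcon t htS, hzV⟩
    choose t htS htU using hex
    -- Membership in `S k` bounds only the first `k` coordinates. Zeroing the others puts the point
    -- in `K` without affecting coordinatewise limits.
    let t' : ℕ → ℕ → ℕ := fun k i => if i < k then t k i else 0
    have ht'K : ∀ k, t' k ∈ K := by
      intro k i _
      by_cases hik : i < k
      · simpa [t', hik] using (hSmem k (t k)).1 (htS k) i hik
      · simp [t', hik]
    obtain ⟨a, haK, φ, hφ, hlim⟩ := hK.tendsto_subseq ht'K
    have hlim2 : Tendsto (fun k => t (φ k)) atTop (𝓝 a) := by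
      rw [tendsto_pi_nhds] at hlim ⊢
      intro i
      refine (hlim i).congr' ?_
      filter_upwards [eventually_gt_atTop i] with k hk
      have : i < φ k := hk.trans_le (hφ.id_le k)
      simp [t', this]
    have hev := (((hh.tendsto a).comp hlim2).eventually
      (hU.mem_nhds (hKU (mem_image_of_mem h haK)))).exists
    obtain ⟨k, hk⟩ := hev
    exact htU _ hk
  refine ⟨K, hK, ?_⟩
  have hanti : Antitone fun k => θ ⁻¹' closure (h '' S k) := by
    refine antitone_nat_of_succ_le fun k => preimage_mono (closure_mono (image_mono ?_))
    rw [hSs]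
    exact inter_subset_left
  have hmeas : ∀ k, NullMeasurableSet (θ ⁻¹' closure (h '' S k)) μ := fun k =>
    (hθ isClosed_closure.measurableSet).nullMeasurableSet
  calc c ≤ ⨅ k, μ (θ ⁻¹' closure (h '' S k)) :=
        le_iInf fun k => (hSpos k).le.trans (measure_mono (preimage_mono subset_closure))
    _ = μ (⋂ k, θ ⁻¹' closure (h '' S k)) :=
        (hanti.measure_iInter hmeas ⟨0, measure_ne_top _ _⟩).symm
    _ ≤ μ (θ ⁻¹' (h '' K)) := by
        rw [← preimage_iInter]
        exact measure_mono (preimage_mono hclosure)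

/-- A continuous map on a compact set attains a minimum of a continuous function on each of its
fibres, and the minimal value depends measurably on the fibre. -/
theorem exists_measurable_minimum_on_fibers {T Y : Type*} [TopologicalSpace T]
    [TopologicalSpace Y] [T2Space Y] [MeasurableSpace Y] [BorelSpace Y] {h : T → Y}
    (hh : Continuous h) {u : T → ℝ} (hu : Continuous u) {K : Set T} (hK : IsCompact K) :
    ∃ m : Y → ℝ, Measurable m ∧ ∀ y ∈ h '' K, ∃ t ∈ K, h t = y ∧ u t = m y := by
  have hatt : ∀ y ∈ h '' K, ∃ t ∈ K, h t = y ∧ u t = sInf (u '' (K ∩ h ⁻¹' {y})) := by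
    rintro y ⟨t₀, ht₀, rfl⟩
    obtain ⟨t, ht, htu⟩ := (hK.inter_right ((isClosed_singleton (x := h t₀)).preimage
      hh)).exists_sInf_image_eq ⟨t₀, ht₀, rfl⟩ hu.continuousOn
    exact ⟨t, ht.1, ht.2, htu.symm⟩
  have hKm : MeasurableSet (h '' K) := (hK.image hh).measurableSet
  refine ⟨fun y => sInf (u '' (K ∩ h ⁻¹' {y})), measurable_of_Iic fun c => ?_, hatt⟩
  have hc : MeasurableSet (h '' (K ∩ u ⁻¹' Iic c)) :=
    ((hK.inter_right (isClosed_Iic.preimage hu)).image hh).measurableSet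
  -- Off `h '' K` the fibre is empty and `sInf ∅ = 0`, whence the second piece.
  have heq : (fun y => sInf (u '' (K ∩ h ⁻¹' {y}))) ⁻¹' Iic c =
      h '' (K ∩ u ⁻¹' Iic c) ∪ ((h '' K)ᶜ ∩ {_y | 0 ≤ c}) := by
    ext y
    by_cases hy : y ∈ h '' K
    · simp only [mem_preimage, mem_Iic, mem_union, mem_inter_iff, mem_compl_iff, hy,
        not_true_eq_false, false_and, or_false]
      constructor
      · intro hle
        obtain ⟨t, htK, hty, htu⟩ := hatt y hy
        exact ⟨t, ⟨htK, by simpa [htu] using hle⟩, hty⟩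
      · rintro ⟨t, ⟨htK, htc⟩, rfl⟩
        have htm : t ∈ K ∩ h ⁻¹' {h t} := ⟨htK, rfl⟩
        refine (csInf_le ?_ (mem_image_of_mem u htm)).trans htc
        exact (hK.bddBelow_image hu.continuousOn).mono (image_mono inter_subset_left)
    · have hempty : K ∩ h ⁻¹' {y} = ∅ := by
        ext t
        simp only [mem_inter_iff, mem_preimage, mem_singleton_iff, mem_empty_iff_false, iff_false]
        rintro ⟨ht, rfl⟩
        exact hy ⟨t, ht, rfl⟩
      have hy' : y ∉ h '' (K ∩ u ⁻¹' Iic c) := fun h' => hy (image_mono inter_subset_left h')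
      simp only [mem_preimage, mem_Iic, mem_union, mem_inter_iff, mem_compl_iff, hy, hy', hempty,
        image_empty, Real.sInf_empty, not_false_eq_true, true_and, false_or, mem_ofPred_eq]
  rw [heq]
  exact hc.union (hKm.compl.inter (MeasurableSet.const _))

/-- **Von Neumann selection**, for almost every point, with values of the parametrization in the
Cantor space. -/
theorem exists_measurable_section_ae_of_cantor {Ω W : Type*} [MeasurableSpace Ω]
    {μ : Measure Ω} [IsFiniteMeasure μ] [MeasurableSpace W] [StandardBorelSpace W] [Nonempty W]
    {Φ : W → ℕ → Bool} (hΦ : Measurable Φ) {θ : Ω → ℕ → Bool} (hθ : Measurable θ)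
    (hr : ∀ᵐ x ∂μ, θ x ∈ range Φ) :
    ∃ s : (ℕ → Bool) → W, Measurable s ∧ ∀ᵐ x ∂μ, Φ (s (θ x)) = θ x := by
  obtain ⟨e, he⟩ : ∃ e : W → ℝ, MeasurableEmbedding e := ⟨_, measurableEmbedding_embeddingReal W⟩
  -- A finer Polish topology on `W` makes `Φ` and `e` continuous. Since `e` is injective, the
  -- minimum of `u` on a fibre determines a point of `W`, which the left inverse `r` of `e`
  -- recovers.
  obtain ⟨g, h, u, hg, hh, hu, hhg, hug⟩ : ∃ (g : (ℕ → ℕ) → W) (h : (ℕ → ℕ) → ℕ → Bool)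
      (u : (ℕ → ℕ) → ℝ), Function.Surjective g ∧ Continuous h ∧ Continuous u ∧
        (∀ t, h t = Φ (g t)) ∧ ∀ t, u t = e (g t) := by
    let := upgradeStandardBorel W
    obtain ⟨t', -, hF, ht'⟩ := (hΦ.prodMk he.measurable).exists_continuous
    obtain ⟨g, hgc, hgs⟩ := @PolishSpace.exists_nat_nat_continuous_surjective W t' ht' _
    have hFg := @Continuous.comp _ _ _ _ t' _ _ _ hF hgc
    exact ⟨g, _, _, hgs, continuous_fst.comp hFg, continuous_snd.comp hFg,
      fun _ => rfl, fun _ => rfl⟩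
  have hrange : ∀ᵐ x ∂μ, θ x ∈ range h := by
    filter_upwards [hr] with x ⟨w, hw⟩
    obtain ⟨t, rfl⟩ := hg w
    exact ⟨t, (hhg t).trans hw⟩
  obtain ⟨r, hrm, hre⟩ := he.exists_measurable_extend (g := id) measurable_id fun _ => inferInstance
  obtain ⟨K, hK, hKμ⟩ : ∃ K : ℕ → Set (ℕ → ℕ), (∀ n, IsCompact (K n)) ∧
      ∀ᵐ x ∂μ, ∃ n, θ x ∈ h '' K n := by
    rcases eq_or_ne (μ univ) 0 with h0 | h0
    · refine ⟨fun _ => ∅, fun _ => isCompact_empty, ?_⟩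
      rw [Measure.measure_univ_eq_zero.1 h0]
      exact ae_zero.le (by simp)
    obtain ⟨c, -, hc, hlim⟩ := exists_seq_strictMono_tendsto' (bot_lt_iff_ne_bot.2 h0)
    choose K hK hKc using fun n =>
      exists_isCompact_le_measure_preimage_image hh hθ hrange (hc n).2
    refine ⟨K, hK, ?_⟩
    have hm : MeasurableSet (⋃ n, θ ⁻¹' (h '' K n)) :=
      MeasurableSet.iUnion fun n => hθ ((hK n).image hh).measurableSet
    have hfull : μ (⋃ n, θ ⁻¹' (h '' K n)) = μ univ := by
      refine le_antisymm (measure_mono (subset_univ _)) (le_of_tendsto' hlim fun n => ?_)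
      exact (hKc n).trans (measure_mono (subset_iUnion (fun n => θ ⁻¹' (h '' K n)) n))
    have := (ae_iff_measure_eq (p := fun x => x ∈ ⋃ n, θ ⁻¹' (h '' K n))
      hm.nullMeasurableSet).2 hfull
    filter_upwards [this] with x hx
    simpa using hx
  choose m hm hmK using fun n => exists_measurable_minimum_on_fibers hh hu (hK n)
  obtain ⟨s, hs, hsK⟩ := exists_measurable_piecewise (disjointed fun n => h '' K n)
    (fun n => MeasurableSet.disjointed (fun k => ((hK k).image hh).measurableSet) n)
    (fun n y => r (m n y)) (fun n => hrm.comp (hm n)) (by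
      intro i j hij y hy
      exact (disjoint_left.1 (disjoint_disjointed _ hij) hy.1 hy.2).elim)
  refine ⟨s, hs, ?_⟩
  filter_upwards [hKμ] with x hx
  have : θ x ∈ ⋃ n, disjointed (fun n => h '' K n) n := by
    rw [iUnion_disjointed]; exact mem_iUnion.2 hx
  obtain ⟨n, hn⟩ := mem_iUnion.1 this
  obtain ⟨t, -, hty, htu⟩ := hmK n (θ x) (disjointed_subset _ n hn)
  have hret : r (e (g t)) = g t := congrFun hre (g t)
  rw [hsK n hn]
  dsimp only
  rw [← htu, hug, hret, ← hhg, hty]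

/-- **Von Neumann selection**, for almost every point: a measurable map on a standard Borel space
whose range contains almost every value of `θ` has a measurable section at almost every value
of `θ`. -/
theorem exists_measurable_section_ae {Ω W Y : Type*} [MeasurableSpace Ω]
    {μ : Measure Ω} [IsFiniteMeasure μ] [MeasurableSpace W] [StandardBorelSpace W] [Nonempty W]
    [MeasurableSpace Y] [MeasurableSpace.CountablySeparated Y]
    {Φ : W → Y} (hΦ : Measurable Φ) {θ : Ω → Y} (hθ : Measurable θ)
    (hr : ∀ᵐ x ∂μ, θ x ∈ range Φ) :
    ∃ s : Y → W, Measurable s ∧ ∀ᵐ x ∂μ, Φ (s (θ x)) = θ x := by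
  obtain ⟨ι, hι, hinj⟩ := MeasurableSpace.measurable_injection_nat_bool_of_countablySeparated Y
  obtain ⟨s, hs, hsec⟩ := exists_measurable_section_ae_of_cantor (μ := μ) (hι.comp hΦ)
    (hι.comp hθ) (by
      filter_upwards [hr] with x ⟨w, hw⟩
      exact ⟨w, congrArg ι hw⟩)
  refine ⟨s ∘ ι, hs.comp hι, ?_⟩
  filter_upwards [hsec] with x hx
  exact hinj hx

/-! ### Lusin's theorem and codes for measurable maps -/

/-- A finite Borel measure on a Polish space is carried by a countable union of compact sets. -/
theorem exists_seq_isCompact_measure_iUnion_eq {M : Type*} [TopologicalSpace M] [PolishSpace M]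
    [MeasurableSpace M] [BorelSpace M] (ν : Measure M) [IsFiniteMeasure ν] :
    ∃ K : ℕ → Set M, (∀ n, IsCompact (K n)) ∧ ν (⋃ n, K n) = ν univ := by
  rcases eq_or_ne (ν univ) 0 with h0 | h0
  · exact ⟨fun _ => ∅, fun _ => isCompact_empty, by simp [h0]⟩
  obtain ⟨c, -, hc, hlim⟩ := exists_seq_strictMono_tendsto' (bot_lt_iff_ne_bot.2 h0)
  choose K _ hK hKc using fun n =>
    MeasurableSet.univ.exists_lt_isCompact_of_ne_top (measure_ne_top ν univ) (hc n).2
  exact ⟨K, hK, le_antisymm (measure_mono (subset_univ _))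
    (le_of_tendsto' hlim fun n => (hKc n).le.trans (measure_mono (subset_iUnion K n)))⟩

/-- Images of closed subsets of `K` are compact, hence closed. This carries continuity from a finer
topology back to the original one. -/
theorem IsCompact.continuousOn_image_of_comp {N M Y : Type*} [TopologicalSpace N]
    [TopologicalSpace M] [T2Space M] [TopologicalSpace Y] {i : N → M} (hi : Continuous i)
    {C : M → Y} (hC : Continuous (C ∘ i)) {K : Set N} (hK : IsCompact K) :
    ContinuousOn C (i '' K) := by
  refine continuousOn_iff_isClosed.2 fun t ht => ⟨i '' (K ∩ (C ∘ i) ⁻¹' t),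
    ((hK.inter_right (ht.preimage hC)).image hi).isClosed, ?_⟩
  ext y
  constructor
  · rintro ⟨hy, x, hx, rfl⟩
    exact ⟨⟨x, ⟨hx, hy⟩, rfl⟩, x, hx, rfl⟩
  · rintro ⟨⟨x, ⟨hx, hy⟩, rfl⟩, hy'⟩
    exact ⟨hy, hy'⟩

/-- **Lusin's theorem** on a Polish space. -/
theorem Measurable.isMeasureContinuous {M Y : Type*} [tM : TopologicalSpace M] [PolishSpace M]
    [mM : MeasurableSpace M] [BorelSpace M] [TopologicalSpace Y] [SecondCountableTopology Y]
    [MeasurableSpace Y] [OpensMeasurableSpace Y] {C : M → Y} (hC : Measurable C)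
    (ν : Measure M) [IsProbabilityMeasure ν] : IsMeasureContinuous ν C := by
  obtain ⟨t', hle, hCt, hpol⟩ := hC.exists_continuous
  have hb : @BorelSpace M t' mM := by
    refine @BorelSpace.mk M t' mM ?_
    rw [@BorelSpace.measurable_eq M tM mM _]
    exact (borel_eq_borel_of_le hpol ‹@PolishSpace M tM› hle).symm
  obtain ⟨K, hK, hKν⟩ := @exists_seq_isCompact_measure_iUnion_eq M t' hpol mM hb ν _
  have hid : @Continuous M M t' tM id := continuous_id_iff_le.2 hle
  refine ⟨K, fun n => ?_, hKν.trans measure_univ, fun n => ?_⟩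
  · simpa using @IsCompact.image M M t' tM _ _ (hK n) hid
  · simpa using @IsCompact.continuousOn_image_of_comp M M Y t' tM _ _ id hid C hCt (K n) (hK n)

/-- Every measurable set agrees almost everywhere with a countable intersection of countable
unions of basic open sets. -/
theorem MeasurableSet.exists_countableBasis_code {M : Type*} [TopologicalSpace M] [PolishSpace M]
    [MeasurableSpace M] [BorelSpace M] {ν : Measure M} [IsFiniteMeasure ν] {B : Set M}
    (hB : MeasurableSet B) :
    ∃ z : ℕ → TopologicalSpace.countableBasis M → Bool,
      ∀ᵐ y ∂ν, (∀ k, ∃ b, z k b = true ∧ y ∈ (b : Set M)) ↔ y ∈ B := by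
  classical
  have hpos : ∀ k : ℕ, ((k : ENNReal) + 1)⁻¹ ≠ 0 := fun k => by simp
  choose U hBU hUo hU using fun k : ℕ => B.exists_isOpen_lt_add (measure_ne_top ν B) (hpos k)
  refine ⟨fun k b => decide ((b : Set M) ⊆ U k), ?_⟩
  have hmem : ∀ y, (∀ k, ∃ b : TopologicalSpace.countableBasis M,
      decide ((b : Set M) ⊆ U k) = true ∧ y ∈ (b : Set M)) ↔ y ∈ ⋂ k, U k := by
    intro y
    rw [mem_iInter]
    refine forall_congr' fun k => ⟨?_, fun hy => ?_⟩
    · rintro ⟨b, hb, hyb⟩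
      exact of_decide_eq_true hb hyb
    · obtain ⟨v, hv, hyv, hvU⟩ :=
        (TopologicalSpace.isBasis_countableBasis M).exists_subset_of_mem_open hy (hUo k)
      exact ⟨⟨v, hv⟩, decide_eq_true hvU, hyv⟩
  have hle : ν (⋂ k, U k) ≤ ν B := by
    have hlim : Tendsto (fun k : ℕ => ν B + ((k : ENNReal) + 1)⁻¹) atTop (𝓝 (ν B + 0)) := by
      refine tendsto_const_nhds.add ?_
      have := (tendsto_add_atTop_iff_nat 1).2 ENNReal.tendsto_inv_nat_nhds_zero
      simpa using this
    rw [add_zero] at hlim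
    exact ge_of_tendsto' hlim fun k => (measure_mono (iInter_subset U k)).trans (hU k).le
  have hae : B =ᵐ[ν] ⋂ k, U k :=
    ae_eq_of_subset_of_measure_ge (subset_iInter hBU) hle hB.nullMeasurableSet
      (measure_ne_top _ _)
  filter_upwards [hae.mem_iff] with y hy
  rw [hmem, hy]

/-- A jointly measurable family, indexed by a standard Borel space, which contains every measurable
map to a standard Borel space up to null sets. -/
theorem exists_universal_measurable_family (M G : Type*) [TopologicalSpace M] [PolishSpace M]
    [MeasurableSpace M] [BorelSpace M] [MeasurableSpace G] [StandardBorelSpace G] [Nonempty G] :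
    ∃ E : (ℕ → ℕ → TopologicalSpace.countableBasis M → Bool) × M → G, Measurable E ∧
      ∀ (ν : Measure M) [IsFiniteMeasure ν] (C : M → G), Measurable C →
        ∃ z, ∀ᵐ y ∂ν, E (z, y) = C y := by
  classical
  obtain ⟨ι, hι, hinj⟩ := MeasurableSpace.measurable_injection_nat_bool_of_countablySeparated G
  obtain ⟨r, hr, hrι⟩ := (hι.measurableEmbedding hinj).exists_measurable_extend (g := id)
    measurable_id fun _ => inferInstance
  -- The `j`-th bit of `ι (C y)` is read off from a code of the set where that bit is true.
  let D : (ℕ → ℕ → TopologicalSpace.countableBasis M → Bool) × M → ℕ → Bool :=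
    fun p j => decide (∀ k, ∃ b, p.1 j k b = true ∧ p.2 ∈ (b : Set M))
  have hD : Measurable D := by
    refine measurable_pi_lambda _ fun j => measurable_to_bool ?_
    have : (fun p => D p j) ⁻¹' {true} = ⋂ k, ⋃ b : TopologicalSpace.countableBasis M,
        {p | p.1 j k b = true} ∩ {p | p.2 ∈ (b : Set M)} := by
      ext p
      simp [D]
    rw [this]
    have := (TopologicalSpace.countable_countableBasis M).to_subtype
    refine MeasurableSet.iInter fun k => MeasurableSet.iUnion fun b => MeasurableSet.inter ?_ ?_
    · have hm : Measurable fun p : (ℕ → ℕ → TopologicalSpace.countableBasis M → Bool) × M =>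
          p.1 j k b := by fun_prop
      exact hm (measurableSet_singleton true)
    · exact measurable_snd
        (TopologicalSpace.isOpen_of_mem_countableBasis b.2).measurableSet
  refine ⟨r ∘ D, hr.comp hD, fun ν _ C hC => ?_⟩
  choose z hz using fun j : ℕ => MeasurableSet.exists_countableBasis_code (ν := ν)
    ((measurable_pi_apply j).comp (hι.comp hC) (measurableSet_singleton true))
  refine ⟨z, ?_⟩
  filter_upwards [ae_all_iff.2 hz] with y hy
  have hDy : D (z, y) = ι (C y) := by
    funext j
    rw [Bool.eq_iff_iff, decide_eq_true_iff]
    exact hy j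
  rw [Function.comp_apply, hDy]
  exact congrFun hrι (C y)

/-! ### Reduction to one Polish group -/

/-- A separable subset of a completely metrizable group is contained in a closed Polish
subgroup. -/
theorem exists_polishSpace_subgroup {Γ : Type*} [Group Γ] [TopologicalSpace Γ]
    [IsTopologicalGroup Γ] [TopologicalSpace.IsCompletelyMetrizableSpace Γ] {S : Set Γ}
    (hS : TopologicalSpace.IsSeparable S) :
    ∃ H : Subgroup Γ, IsClosed (H : Set Γ) ∧ S ⊆ H ∧ PolishSpace H := by
  obtain ⟨c, hc, hSc⟩ := hS
  have hcc : ((Subgroup.closure c : Subgroup Γ) : Set Γ).Countable := by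
    have := hc.to_subtype
    rw [FreeGroup.closure_eq_range, MonoidHom.coe_range]
    exact countable_range _
  have hcl : IsClosed (((Subgroup.closure c).topologicalClosure : Subgroup Γ) : Set Γ) :=
    Subgroup.isClosed_topologicalClosure _
  refine ⟨(Subgroup.closure c).topologicalClosure, hcl,
    hSc.trans (closure_mono Subgroup.subset_closure), ?_⟩
  have hsep : TopologicalSpace.IsSeparable
      (((Subgroup.closure c).topologicalClosure : Subgroup Γ) : Set Γ) :=
    ⟨Subgroup.closure c, hcc, le_rfl⟩
  let := TopologicalSpace.upgradeIsCompletelyMetrizable Γ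
  have hsc : SecondCountableTopology (Subgroup.closure c).topologicalClosure :=
    hsep.secondCountableTopology
  have hcm := hcl.isClosedEmbedding_subtypeVal.IsCompletelyMetrizableSpace
  exact { hsc, hcm with }

/-- A solution which takes values in a Polish group can be changed, by right multiplication with
an invariant function, to take values in any closed subgroup that contains the values of `A`. -/
theorem exists_measurable_solution_mem {M H : Type*} [TopologicalSpace M] [PolishSpace M]
    [MeasurableSpace M] [BorelSpace M] {f : M → M} {ν : Measure M} [IsProbabilityMeasure ν]
    [Group H] [TopologicalSpace H] [IsTopologicalGroup H]
    [PolishSpace H] [MeasurableSpace H] [BorelSpace H] {G : Subgroup H}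
    (hG : IsClosed (G : Set H)) {A C : M → H} (hA : ∀ᵐ y ∂ν, A y ∈ G) (hC : Measurable C)
    (hsol : ∀ᵐ y ∂ν, C (f y) = A y * C y) :
    ∃ D : M → H, Measurable D ∧ (∀ᵐ y ∂ν, D y ∈ G) ∧ ∀ᵐ y ∂ν, D (f y) = A y * D y := by
  have : Nonempty M := ν.nonempty_of_neZero
  let : MeasurableSpace (H ⧸ G) := borel (H ⧸ G)
  have : BorelSpace (H ⧸ G) := ⟨rfl⟩
  have := hG
  let Φ : M → H ⧸ G := fun y => QuotientGroup.mk (C y)⁻¹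
  have hΦ : Measurable Φ := (QuotientGroup.continuous_mk (N := G)).measurable.comp hC.inv
  obtain ⟨s, hs, hsΦ⟩ := exists_measurable_section_ae (μ := ν) hΦ hΦ
    (Eventually.of_forall fun y => ⟨y, rfl⟩)
  refine ⟨fun y => C y * (C (s (Φ y)))⁻¹, hC.mul (hC.comp (hs.comp hΦ)).inv, ?_, ?_⟩
  · filter_upwards [hsΦ] with y hy
    simpa using QuotientGroup.eq.1 hy.symm
  · filter_upwards [hsol, hA] with y hy hAy
    -- `C (f y)⁻¹ = C(y)⁻¹ A(y)⁻¹` differs from `C(y)⁻¹` by a right factor in `G`.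
    have hΦf : Φ (f y) = Φ y := by
      refine QuotientGroup.eq.2 ?_
      simpa [hy] using hAy
    rw [hΦf, hy, mul_assoc]

/-- The images of the compact sets are separable, so together with `S` they lie in a Polish
subgroup, where measurable selection applies. -/
theorem IsMeasureContinuous.exists_measurable_subgroup {M Γ : Type*} [TopologicalSpace M]
    [PolishSpace M] [MeasurableSpace M] [BorelSpace M] [Group Γ] [TopologicalSpace Γ]
    [IsTopologicalGroup Γ] [TopologicalSpace.IsCompletelyMetrizableSpace Γ] {ν : Measure M}
    [IsProbabilityMeasure ν] {C : M → Γ} (hC : IsMeasureContinuous ν C) {S : Set Γ}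
    (hS : TopologicalSpace.IsSeparable S) :
    ∃ H : Subgroup Γ, IsClosed (H : Set Γ) ∧ S ⊆ H ∧ PolishSpace H ∧
      ∃ D : M → H, Measurable[_, borel H] D ∧ ∀ᵐ y ∂ν, (D y : Γ) = C y := by
  classical
  obtain ⟨K, hK, hKν, hCK⟩ := hC
  have hsep : TopologicalSpace.IsSeparable (⋃ n, C '' K n) :=
    .iUnion fun n => ((hK n).image_of_continuousOn (hCK n)).isSeparable
  obtain ⟨H, hHc, hHS, hHp⟩ := exists_polishSpace_subgroup (hS.union hsep)
  refine ⟨H, hHc, subset_union_left.trans hHS, hHp, ?_⟩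
  have hCH : ∀ y ∈ ⋃ n, K n, C y ∈ H := by
    intro y hy
    obtain ⟨n, hn⟩ := mem_iUnion.1 hy
    exact hHS (Or.inr (mem_iUnion.2 ⟨n, y, hn, rfl⟩))
  have hKm : MeasurableSet (⋃ n, K n) := .iUnion fun n => (hK n).measurableSet
  let : MeasurableSpace H := borel H
  have : BorelSpace H := ⟨rfl⟩
  let D : M → H := fun y => if hy : y ∈ ⋃ n, K n then ⟨C y, hCH y hy⟩ else 1
  have hD : ∀ y ∈ ⋃ n, K n, (D y : Γ) = C y := fun y hy => by simp only [D, dif_pos hy]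
  refine ⟨D, measurable_of_isClosed fun t ht => ?_, ?_⟩
  · have heq : D ⁻¹' t = (⋃ n, K n ∩ C ⁻¹' (Subtype.val '' t)) ∪
        ((⋃ n, K n)ᶜ ∩ {_y | (1 : H) ∈ t}) := by
      ext y
      by_cases hy : y ∈ ⋃ n, K n
      · have hmem : y ∈ (⋃ n, K n ∩ C ⁻¹' (Subtype.val '' t)) ↔ D y ∈ t := by
          rw [← iUnion_inter, mem_inter_iff, mem_preimage, ← hD y hy,
            Subtype.val_injective.mem_set_image]
          exact and_iff_right hy
        rw [mem_union, hmem, mem_preimage]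
        exact ⟨Or.inl, fun h => h.elim id fun h => absurd hy h.1⟩
      · have hDy : D y = 1 := dif_neg hy
        have hmem : y ∉ ⋃ n, K n ∩ C ⁻¹' (Subtype.val '' t) := by
          rw [← iUnion_inter]; exact fun h => hy h.1
        rw [mem_preimage, hDy, mem_union]
        exact ⟨fun h => Or.inr ⟨hy, h⟩, fun h => h.elim (fun h => absurd h hmem) fun h => h.2⟩
    rw [heq]
    refine .union (.iUnion fun n => ?_) (hKm.compl.inter (.const _))
    exact ((hCK n).preimage_isClosed_of_isClosed (hK n).isClosed
      (hHc.isClosedEmbedding_subtypeVal.isClosedMap t ht)).measurableSet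
  · have := (prob_compl_eq_zero_iff hKm).2 hKν
    filter_upwards [compl_mem_ae_iff.2 this] with y hy
    exact hD y (by simpa using hy)

/-- A measure-continuous solution yields a measurable solution with values in any closed subgroup
which contains the values of `A`. -/
theorem SolvesCohomologicalEquation.exists_measurable_subgroup {M Γ : Type*}
    [TopologicalSpace M] [PolishSpace M] [MeasurableSpace M] [BorelSpace M] [Group Γ]
    [TopologicalSpace Γ] [IsTopologicalGroup Γ] [TopologicalSpace.IsCompletelyMetrizableSpace Γ]
    {f : M → M} {ν : Measure M} [IsProbabilityMeasure ν] (hf : MeasurePreserving f ν ν)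
    {A C : M → Γ} (hA : TopologicalSpace.IsSeparable (range A)) (hC : IsMeasureContinuous ν C)
    (hsol : SolvesCohomologicalEquation f ν A C) {G : Subgroup Γ} (hG : IsClosed (G : Set Γ))
    [MeasurableSpace G] [BorelSpace G] (hAG : ∀ y, A y ∈ G) :
    ∃ D : M → G, Measurable D ∧ ∀ᵐ y ∂ν, (D (f y) : Γ) = A y * D y := by
  obtain ⟨H, hHc, hAH, hHp, C₁, hC₁, hC₁C⟩ := hC.exists_measurable_subgroup hA
  let : MeasurableSpace H := borel H
  have : BorelSpace H := ⟨rfl⟩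
  let : MeasurableSpace Γ := borel Γ
  have : BorelSpace Γ := ⟨rfl⟩
  have hGH : IsClosed (G.subgroupOf H : Set H) := hG.preimage continuous_subtype_val
  obtain ⟨D, hD, hDG, hDs⟩ := exists_measurable_solution_mem (f := f) hGH (C := C₁)
    (A := fun y => ⟨A y, hAH ⟨y, rfl⟩⟩) (Eventually.of_forall fun y => hAG y) hC₁ (by
      filter_upwards [hsol, hC₁C, hf.quasiMeasurePreserving.ae hC₁C] with y h1 h2 h3
      refine Subtype.ext ?_
      change (C₁ (f y) : Γ) = A y * C₁ y
      rw [h3, h2, h1, inv_mul_cancel_right])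
  obtain ⟨r, hr, hrG⟩ := (MeasurableEmbedding.subtype_coe
    hG.measurableSet).exists_measurable_extend (g := fun x : G => x) (by
      have : (Subtype.instMeasurableSpace : MeasurableSpace G) = borel G :=
        (Subtype.borelSpace (G : Set Γ)).measurable_eq
      intro t ht
      rw [BorelSpace.measurable_eq (α := G), ← this] at ht
      exact ht) fun _ => ⟨1⟩
  refine ⟨fun y => r (D y), hr.comp (continuous_subtype_val.measurable.comp hD), ?_⟩
  have hrD : ∀ᵐ y ∂ν, (r (D y) : Γ) = D y := by
    filter_upwards [hDG] with y hy
    exact congrArg Subtype.val (congrFun hrG ⟨D y, hy⟩)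
  filter_upwards [hrD, hf.quasiMeasurePreserving.ae hrD, hDs] with y h1 h2 h3
  rw [h1, h2, h3]
  rfl

/-! ### Conditional measures -/

/-- A measurable parametrization of the measures in a Markov kernel by points of the Cantor
space. -/
theorem ProbabilityTheory.Kernel.exists_measurable_code {α β : Type*} [MeasurableSpace α]
    [mβ : MeasurableSpace β] [MeasurableSpace.CountablyGenerated β] (κ : Kernel α β)
    [IsMarkovKernel κ] :
    ∃ θ : α → ℕ → Bool, Measurable θ ∧ ∀ a a', θ a = θ a' → κ a = κ a' := by
  let 𝒜 := generateSetAlgebra (MeasurableSpace.countableGeneratingSet β)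
  have h𝒜 : MeasurableSpace.generateFrom 𝒜 = mβ := by
    rw [generateFrom_generateSetAlgebra_eq, MeasurableSpace.generateFrom_countableGeneratingSet]
  have : Countable 𝒜 :=
    (countable_generateSetAlgebra MeasurableSpace.countable_countableGeneratingSet).to_subtype
  obtain ⟨ι, hι, hinj⟩ :=
    MeasurableSpace.measurable_injection_nat_bool_of_countablySeparated (𝒜 → ENNReal)
  refine ⟨fun a => ι fun s => κ a s, hι.comp (measurable_pi_lambda _ fun s =>
    κ.measurable_coe ?_), fun a a' h => ?_⟩
  · rw [← h𝒜]
    exact MeasurableSpace.measurableSet_generateFrom s.2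
  · refine ext_of_generate_finite 𝒜 h𝒜.symm (fun s hs t ht _ =>
      isSetAlgebra_generateSetAlgebra.inter_mem hs ht) (fun s hs => ?_) (by simp)
    exact congrFun (hinj h) ⟨s, hs⟩

/-- The conditional measures given the invariant sets are almost surely invariant. -/
theorem MeasureTheory.MeasurePreserving.condExpKernel_invariants {M : Type*} [mM : MeasurableSpace M]
    [StandardBorelSpace M] {f : M → M} {μ : Measure M} [IsFiniteMeasure μ]
    (hf : MeasurePreserving f μ μ) :
    ∀ᵐ x ∂μ, MeasurePreserving f (condExpKernel μ (MeasurableSpace.invariants f) x)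
      (condExpKernel μ (MeasurableSpace.invariants f) x) := by
  have hm := MeasurableSpace.invariants_le f
  have hset : ∀ s : Set M, MeasurableSet s → ∀ᵐ x ∂μ,
      condExpKernel μ (MeasurableSpace.invariants f) x (f ⁻¹' s) =
        condExpKernel μ (MeasurableSpace.invariants f) x s := by
    intro s hs
    have hce : μ⟦f ⁻¹' s | MeasurableSpace.invariants f⟧ =ᵐ[μ]
        μ⟦s | MeasurableSpace.invariants f⟧ := by
      refine ae_eq_condExp_of_forall_setIntegral_eq hm
        ((integrable_const (1 : ℝ)).indicator hs) (fun t _ _ => integrable_condExp.integrableOn)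
        (fun t ht _ => ?_) stronglyMeasurable_condExp.aestronglyMeasurable
      rw [setIntegral_condExp hm ((integrable_const (1 : ℝ)).indicator (hf.measurable hs)) ht,
        setIntegral_indicator (hf.measurable hs), setIntegral_indicator hs, setIntegral_const,
        setIntegral_const]
      congr 1
      have ht' := MeasurableSpace.measurableSet_invariants.1 ht
      -- For invariant `t`, `t ∩ f⁻¹ s` is the preimage of `t ∩ s`.
      rw [measureReal_def, measureReal_def,
        ← hf.measure_preimage (ht'.1.inter hs).nullMeasurableSet, preimage_inter, ht'.2]
    filter_upwards [condExpKernel_ae_eq_condExp hm (hf.measurable hs),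
      condExpKernel_ae_eq_condExp hm hs, hce] with x h1 h2 h3
    rw [← measureReal_eq_measureReal_iff, h1, h2, h3]
  let 𝒜 := generateSetAlgebra (MeasurableSpace.countableGeneratingSet M)
  have h𝒜 : MeasurableSpace.generateFrom 𝒜 = mM := by
    rw [generateFrom_generateSetAlgebra_eq, MeasurableSpace.generateFrom_countableGeneratingSet]
  have h𝒜m : ∀ s ∈ 𝒜, MeasurableSet s := fun s hs => by
    rw [← h𝒜]
    exact MeasurableSpace.measurableSet_generateFrom hs
  have h𝒜c : 𝒜.Countable :=
    countable_generateSetAlgebra MeasurableSpace.countable_countableGeneratingSet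
  filter_upwards [(ae_ball_iff h𝒜c).2 fun s hs => hset s (h𝒜m s hs)] with x hx
  refine ⟨hf.measurable, ?_⟩
  refine ext_of_generate_finite 𝒜 h𝒜.symm (fun s hs t ht _ =>
    isSetAlgebra_generateSetAlgebra.inter_mem hs ht) (fun s hs => ?_) ?_
  · rw [Measure.map_apply hf.measurable (h𝒜m s hs), hx s hs]
  · rw [Measure.map_apply hf.measurable .univ, preimage_univ]

/-- A property of pairs which holds almost everywhere for the conditional measures holds almost
everywhere on the diagonal. -/
theorem ae_diag_of_ae_condExpKernel {Ω : Type*} {m : MeasurableSpace Ω} [mΩ : MeasurableSpace Ω]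
    [StandardBorelSpace Ω] (hm : m ≤ mΩ) {μ : Measure Ω} [IsFiniteMeasure μ]
    {p : Ω × Ω → Prop} (hp : MeasurableSet[m.prod mΩ] {q | p q})
    (h : ∀ᵐ x ∂μ, ∀ᵐ y ∂condExpKernel μ m x, p (x, y)) : ∀ᵐ x ∂μ, p (x, x) := by
  have hmeas : MeasurableSet[m] {x | ∀ᵐ y ∂condExpKernel μ m x, p (x, y)} := by
    have := @Kernel.measurable_kernel_prodMk_left Ω Ω m mΩ (condExpKernel μ m) _ _ hp.compl
    exact this (measurableSet_singleton 0)
  have htrim : ∀ᵐ x ∂μ.trim hm, ∀ᵐ y ∂condExpKernel μ m x, p (x, y) := by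
    rw [ae_iff] at h ⊢
    exact (trim_measurableSet_eq hm hmeas.compl).trans h
  have hprod := (@Measure.ae_compProd_iff Ω Ω m mΩ (μ.trim hm) (condExpKernel μ m) _ _ p hp).2 htrim
  -- Averaging the conditional measures gives the image of `μ` on the diagonal.
  rw [compProd_trim_condExpKernel hm] at hprod
  have hdiag : @Measurable Ω (Ω × Ω) mΩ (m.prod mΩ) Function.diag :=
    (measurable_id'' hm).prodMk measurable_id
  exact (@ae_map_iff Ω (Ω × Ω) mΩ (m.prod mΩ) μ _ (@Measurable.aemeasurable _ _ mΩ (m.prod mΩ) _ _ hdiag) _ hp).1 hprod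

/-! ### Gluing the solutions -/

/-- A cohomological equation with values in a completely metrizable group which is solvable on
almost every ergodic component is solvable. -/
theorem exists_solvesCohomologicalEquation_of_ergodicComponent {M Γ : Type*}
    [TopologicalSpace M] [PolishSpace M] [MeasurableSpace M] [BorelSpace M] [Group Γ]
    [TopologicalSpace Γ] [IsTopologicalGroup Γ] [TopologicalSpace.IsCompletelyMetrizableSpace Γ]
    {f : M → M} {μ : Measure M} [IsProbabilityMeasure μ] (hμ : MeasurePreserving f μ μ)
    {A : M → Γ} (hA : Continuous A)
    (hsol : ∀ᵐ x ∂μ, ∃ C : M → Γ, IsMeasureContinuous (ergodicComponent f μ x) C ∧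
      SolvesCohomologicalEquation f (ergodicComponent f μ x) A C) :
    ∃ C : M → Γ, IsMeasureContinuous μ C ∧ SolvesCohomologicalEquation f μ A C := by
  have hsep : TopologicalSpace.IsSeparable (range A) := TopologicalSpace.isSeparable_range hA
  obtain ⟨G, hGc, hAG, hGp⟩ := exists_polishSpace_subgroup hsep
  let : MeasurableSpace G := borel G
  have : BorelSpace G := ⟨rfl⟩
  let B : M → G := fun y => ⟨A y, hAG ⟨y, rfl⟩⟩
  have hB : Measurable B := (hA.subtype_mk _).measurable
  have hf := hμ.measurable
  have hI := MeasurableSpace.invariants_le f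
  let κ := condExpKernel μ (MeasurableSpace.invariants f)
  obtain ⟨E, hE, hEC⟩ := exists_universal_measurable_family M G
  let Z := ℕ → ℕ → TopologicalSpace.countableBasis M → Bool
  have hcb := (TopologicalSpace.countable_countableBasis M).to_subtype
  let R : Set (M × Z) := {p | ∀ᵐ y ∂κ p.1, E (p.2, f y) = B y * E (p.2, y)}
  have hR : MeasurableSet R := by
    let κ' : Kernel (M × Z) M := @Kernel.comap M M (MeasurableSpace.invariants f) _ (M × Z) _ κ
      Prod.fst ((measurable_id'' hI).comp measurable_fst)
    have hT : MeasurableSet {q : (M × Z) × M | E (q.1.2, f q.2) = B q.2 * E (q.1.2, q.2)} :=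
      measurableSet_eq_fun (by fun_prop) (by fun_prop)
    exact Kernel.measurable_kernel_prodMk_left (κ := κ') hT.compl (measurableSet_singleton 0)
  obtain ⟨θ, hθ, hθκ⟩ := @Kernel.exists_measurable_code M M (MeasurableSpace.invariants f) _ _ κ _
  have hθm : Measurable θ := hθ.mono hI le_rfl
  have hθf : ∀ x, θ (f x) = θ x :=
    congrFun (MeasurableSpace.comp_eq_of_measurable_invariants hθ)
  have hcode : ∀ᵐ x ∂μ, ∃ z, (x, z) ∈ R := by
    filter_upwards [hsol, hμ.condExpKernel_invariants] with x ⟨C, hC, hCs⟩ hx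
    have : IsProbabilityMeasure (ergodicComponent f μ x) :=
      inferInstanceAs (IsProbabilityMeasure (κ x))
    obtain ⟨D, hD, hDs⟩ := hCs.exists_measurable_subgroup hx hsep hC hGc fun y => hAG ⟨y, rfl⟩
    obtain ⟨z, hz⟩ := hEC (κ x) D hD
    refine ⟨z, ?_⟩
    filter_upwards [hz, hx.quasiMeasurePreserving.ae hz, hDs] with y h1 h2 h3
    rw [h1, h2]
    exact Subtype.ext h3
  have hRne : Nonempty R := by
    obtain ⟨x, z, hz⟩ := hcode.exists
    exact ⟨⟨(x, z), hz⟩⟩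
  have : StandardBorelSpace R := hR.standardBorel
  obtain ⟨s, hs, hsθ⟩ := exists_measurable_section_ae (μ := μ) (Φ := fun w : R => θ w.1.1)
    (hθm.comp (measurable_fst.comp measurable_subtype_coe)) hθm (by
      filter_upwards [hcode] with x ⟨z, hz⟩
      exact ⟨⟨(x, z), hz⟩, rfl⟩)
  let ζ : (ℕ → Bool) → Z := fun t => (s t).1.2
  have hζ : Measurable ζ := measurable_snd.comp (measurable_subtype_coe.comp hs)
  have hfiber : ∀ᵐ x ∂μ, ∀ᵐ y ∂κ x, E (ζ (θ x), f y) = B y * E (ζ (θ x), y) := by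
    filter_upwards [hsθ] with x hx
    -- The selected base point may differ from `x`, but it has the same conditional measure, so its
    -- code also works at `x`.
    rw [← hθκ _ _ hx]
    exact (s (θ x)).2
  have hdiag : ∀ᵐ x ∂μ, E (ζ (θ x), f x) = B x * E (ζ (θ x), x) := by
    refine ae_diag_of_ae_condExpKernel hI
      (p := fun q => E (ζ (θ q.1), f q.2) = B q.2 * E (ζ (θ q.1), q.2)) ?_ hfiber
    have hT : MeasurableSet {q : Z × M | E (q.1, f q.2) = B q.2 * E (q.1, q.2)} :=
      measurableSet_eq_fun (by fun_prop) (by fun_prop)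
    have hm : @Measurable (M × M) (Z × M) ((MeasurableSpace.invariants f).prod _) _
        (Prod.map (ζ ∘ θ) id) :=
      @Measurable.prodMap _ _ _ _ (MeasurableSpace.invariants f) _ _ _ _ _ (hζ.comp hθ)
        measurable_id
    exact hm hT
  let C : M → G := fun x => E (ζ (θ x), x)
  have hC : Measurable C := hE.comp ((hζ.comp hθm).prodMk measurable_id)
  refine ⟨fun x => C x, ?_, ?_⟩
  · obtain ⟨K, hK, hKμ, hCK⟩ := hC.isMeasureContinuous μ
    exact ⟨K, hK, hKμ, fun n => continuous_subtype_val.comp_continuousOn (hCK n)⟩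
  · filter_upwards [hdiag] with x hx
    have hCf : C (f x) = B x * C x := by
      simp only [C, hθf]
      exact hx
    rw [hCf, Subgroup.coe_mul, mul_inv_cancel_right]

theorem Units.isCompletelyMetrizableSpace {R : Type*} [NormedRing R] [CompleteSpace R] :
    TopologicalSpace.IsCompletelyMetrizableSpace Rˣ :=
  Units.isClosedEmbedding_embedProduct.IsCompletelyMetrizableSpace

theorem theorem3p4 {𝕜 X M : Type*} [RCLike 𝕜]
    [NormedAddCommGroup X] [NormedSpace 𝕜 X] [CompleteSpace X]
    [TopologicalSpace M] [PolishSpace M] [MeasurableSpace M] [BorelSpace M]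
    (f : M ≃ₜ M) (μ : Measure M) [IsProbabilityMeasure μ] (hμ : MeasurePreserving f μ μ)
    (A : M → BanachGL 𝕜 X) (hA : Continuous A)
    (hsol : ∀ᵐ x ∂μ, ∃ C : M → BanachGL 𝕜 X,
      IsMeasureContinuous (ergodicComponent f μ x) C ∧
        SolvesCohomologicalEquation f (ergodicComponent f μ x) A C) :
    ∃ C : M → BanachGL 𝕜 X,
      IsMeasureContinuous μ C ∧ SolvesCohomologicalEquation f μ A C := by
  have := Units.isCompletelyMetrizableSpace (R := X →L[𝕜] X)
  exact exists_solvesCohomologicalEquation_of_ergodicComponent hμ hA hsol
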